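/- For an integer $n\ge 1$, an integer $g\ge 0$ and non-negative integers $i_1,\dots,i_n$ let $$\mathrm{og}_g(i_1,\dots,i_n)=\sum_{\Gamma}\frac{1}{n!\,|\mathrm{Aut}\,\Gamma|}$$ be the weighted number of connected ordinary graphs of genus $g$ with $n$ vertices of valencies $i_1,\dots,i_n$. Here $\Gamma$ runs over the isomorphism classes of connected graphs (loops and multiple edges allowed, a loop contributing $2$ to the valency of its vertex) with vertices labelled $1,\dots,n$ of valencies $i_1,\dots,i_n$ and with genus $\#\mathrm{edges}-n+1=g$; isomorphisms and automorphisms are bijections of the half-edges that fix every vertex and take edges to edges. (Thus $i_1!\cdots i_n!\,n!\,\mathrm{og}_g(i_1,\dots,i_n)$ is the number of pairings of the $i_1+\dots+i_n=2g+2n-2$ half-edges which give a connected graph.) Put $$\mathcal G^{\mathrm{og}}_{i_1,\dots,i_n}(g)=\frac{i_1!\cdots i_n!\,n!}{(2g+2n-3)!!}\,\mathrm{og}_g(i_1,\dots,i_n),\qquad (-1)!!:=1.$$ Theorem. For fixed $n\ge1$ and fixed integers $i_1,\dots,i_{n-1}\ge1$, with $|i|=i_1+\dots+i_{n-1}$,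 there exists a rational function $R^{\mathrm{og}}(g;i_1,\dots,i_{n-1})$ of $g$ with rational coefficients, which may depend on $n,i_1,\dots,i_{n-1}$, such that for every integer $g\ge0$ with $2g+2n-2-|i|\ge0$ the function $R^{\mathrm{og}}$ has no pole at $g$ and $$\mathcal G^{\mathrm{og}}_{i_1,\dots,i_{n-1},\,2g+2n-2-|i|}(g)=R^{\mathrm{og}}(g;i_1,\dots,i_{n-1}).$$ -/

import Mathlib

/-- The half-edges of a graph with vertices labelled by `Fin n`, in which the vertex `k` has
valency `i k`: the half-edge `⟨k, a⟩` is the `a`-th half-edge attached to `k`. -/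
abbrev HalfEdge {n : ℕ} (i : Fin n → ℕ) : Type := Σ k : Fin n, Fin (i k)

/-- An ordinary graph (loops and multiple edges allowed) with vertices labelled by `Fin n` of
valencies `i 0, …, i (n - 1)`: a gluing of the half-edges in pairs.  A loop contributes `2` to
the valency of its vertex.  Half-edges carry names here; the names are forgotten by passing to
isomorphism classes, and every finite graph with these valencies is isomorphic to one of
these. -/
@[ext]
structure OrdinaryGraph {n : ℕ} (i : Fin n → ℕ) : Type where
  /-- the other half of the edge that contains a given half-edge -/
  mate : HalfEdge i → HalfEdge i
  mate_mate : ∀ h, mate (mate h) = h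
  mate_ne : ∀ h, mate h ≠ h

namespace OrdinaryGraph

variable {n : ℕ} {i : Fin n → ℕ}

instance : Finite (OrdinaryGraph i) :=
  Finite.of_injective OrdinaryGraph.mate fun _ _ h => OrdinaryGraph.ext h

/-- The underlying simple graph on the vertex set: loops are dropped, multiplicities forgotten. -/
def toSimpleGraph (Γ : OrdinaryGraph i) : SimpleGraph (Fin n) :=
  SimpleGraph.fromRel fun u v => ∃ h : HalfEdge i, h.1 = u ∧ (Γ.mate h).1 = v

/-- The edges: unordered pairs of half-edges that are glued together. -/
def edges (Γ : OrdinaryGraph i) : Finset (Sym2 (HalfEdge i)) :=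
  Finset.univ.image fun h => s(h, Γ.mate h)

/-- The genus (number of independent cycles) of a connected graph:
`#edges - #vertices + 1`. -/
def genus (Γ : OrdinaryGraph i) : ℤ := (Γ.edges.card : ℤ) - (n : ℤ) + 1

/-- `φ` is an isomorphism from `Γ` to `Δ`: a bijection of the half-edges which keeps every
half-edge at its vertex and takes edges to edges. -/
def IsIso (Γ Δ : OrdinaryGraph i) (φ : Equiv.Perm (HalfEdge i)) : Prop :=
  (∀ h, (φ h).1 = h.1) ∧ ∀ h, φ (Γ.mate h) = Δ.mate (φ h)

theorem IsIso.refl (Γ : OrdinaryGraph i) : IsIso Γ Γ 1 :=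
  ⟨fun _ => rfl, fun _ => rfl⟩

theorem IsIso.symm {Γ Δ : OrdinaryGraph i} {φ : Equiv.Perm (HalfEdge i)} (h : IsIso Γ Δ φ) :
    IsIso Δ Γ φ⁻¹ := by
  refine ⟨fun x => ?_, fun x => ?_⟩
  · have := h.1 (φ⁻¹ x)
    simpa using this.symm
  · have := h.2 (φ⁻¹ x)
    simp only [← Equiv.Perm.mul_apply, mul_inv_cancel, Equiv.Perm.one_apply] at this
    rw [← this, ← Equiv.Perm.mul_apply, inv_mul_cancel, Equiv.Perm.one_apply]

theorem IsIso.trans {Γ Δ Θ : OrdinaryGraph i} {φ ψ : Equiv.Perm (HalfEdge i)}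
    (h : IsIso Γ Δ φ) (h' : IsIso Δ Θ ψ) : IsIso Γ Θ (ψ * φ) :=
  ⟨fun x => (h'.1 (φ x)).trans (h.1 x), fun x => by
    simp only [Equiv.Perm.mul_apply, h.2, h'.2]⟩

/-- The order of the automorphism group of `Γ`. -/
noncomputable def autCard (Γ : OrdinaryGraph i) : ℕ :=
  Nat.card {φ : Equiv.Perm (HalfEdge i) // IsIso Γ Γ φ}

theorem autCard_eq_of_isIso {Γ Δ : OrdinaryGraph i} {φ : Equiv.Perm (HalfEdge i)}
    (h : IsIso Γ Δ φ) : Γ.autCard = Δ.autCard :=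
  Nat.card_congr
    { toFun := fun α => ⟨φ * (α.1 * φ⁻¹), (h.symm.trans α.2).trans h⟩
      invFun := fun β => ⟨φ⁻¹ * (β.1 * φ), (h.trans β.2).trans h.symm⟩
      left_inv := fun α => Subtype.ext (by simp [mul_assoc])
      right_inv := fun β => Subtype.ext (by simp [mul_assoc]) }

end OrdinaryGraph

/-- The connected ordinary graphs of genus `g` with vertices of valencies `i`. -/
def ConnectedGraph {n : ℕ} (g : ℕ) (i : Fin n → ℕ) : Type :=
  {Γ : OrdinaryGraph i // Γ.toSimpleGraph.Connected ∧ Γ.genus = (g : ℤ)}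

namespace ConnectedGraph

variable {n : ℕ} {g : ℕ} {i : Fin n → ℕ}

instance : Finite (ConnectedGraph g i) :=
  inferInstanceAs (Finite {Γ : OrdinaryGraph i // Γ.toSimpleGraph.Connected ∧ Γ.genus = (g : ℤ)})

/-- Two graphs are equivalent when they are isomorphic. -/
instance isoSetoid (g : ℕ) (i : Fin n → ℕ) : Setoid (ConnectedGraph g i) where
  r Γ Δ := ∃ φ, OrdinaryGraph.IsIso Γ.1 Δ.1 φ
  iseqv :=
    { refl := fun Γ => ⟨1, OrdinaryGraph.IsIso.refl Γ.1⟩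
      symm := fun ⟨φ, h⟩ => ⟨φ⁻¹, h.symm⟩
      trans := fun ⟨φ, h⟩ ⟨ψ, h'⟩ => ⟨ψ * φ, h.trans h'⟩ }

/-- The weight `1 / |Aut Γ|` of an isomorphism class. -/
noncomputable def classWeight (c : Quotient (isoSetoid g i)) : ℚ :=
  Quotient.lift (fun Γ : ConnectedGraph g i => (1 : ℚ) / (Γ.1.autCard : ℚ))
    (fun Γ Δ hΓΔ => by
      obtain ⟨_, h⟩ : ∃ φ, OrdinaryGraph.IsIso Γ.1 Δ.1 φ := hΓΔ
      change (1 : ℚ) / (Γ.1.autCard : ℚ) = 1 / (Δ.1.autCard : ℚ)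
      rw [OrdinaryGraph.autCard_eq_of_isIso h]) c

end ConnectedGraph

/-- The weighted number `og_g(i_1, …, i_n)` of connected ordinary graphs of genus `g` with `n`
vertices of valencies `i_1, …, i_n`: the sum of `1 / (n! |Aut Γ|)` over the isomorphism classes
of vertex-labelled graphs (a sum over a finite type).  Equivalently, `i_1! ⋯ i_n! n! og_g` is the
number of connected pairings of the half-edges. -/
noncomputable def ogCount {n : ℕ} (g : ℕ) (i : Fin n → ℕ) : ℚ :=
  (1 / (n.factorial : ℚ)) *
    ∑ᶠ c : Quotient (ConnectedGraph.isoSetoid g i), ConnectedGraph.classWeight c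

/-- The normalized number `i_1! ⋯ i_n! n! / (2g+2n-3)!! · og_g(i_1, …, i_n)`, for `1 ≤ n`.
The only case with `2g+2n-3 < 0` is `g = 0, n = 1`, where the truncated difference gives the
value `0!! = 1`, which is the conventional value of `(-1)!!`. -/
noncomputable def normalizedOg {n : ℕ} (g : ℕ) (i : Fin n → ℕ) : ℚ :=
  ((∏ k, ((i k).factorial : ℚ)) * (n.factorial : ℚ)) /
    (Nat.doubleFactorial (2 * g + 2 * n - 3) : ℚ) * ogCount g i

/-! By orbit-stabilizer (`ConnectedGraph.card_class_mul_autCard`) the weighted count times its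
factorials is the number of connected pairings of the 2E half-edges, E = g + n - 1. Division by
(2E-1)!!, the number of all pairings, turns it into the probability that a random pairing is
connected.

Sort the pairings by the component t of the last vertex r, the only one whose valency varies with g.
The number W of half-edges outside t is then fixed. By `Pairing.reachCount_eq_mul` and induction on
the vertex set, a proper t has probability zero if W is odd, and otherwise a constant times a
rational function of E - W/2 times the product of 1/(2(E-j)-1) over j < W/2. Subtracting these from
1 leaves the probability of connectedness (`Pairing.exists_regularRational_reachCount`). The
denominators are products of numbers that are odd at integers, so no integer is a pole. -/

/-- A perfect matching of the elements of `H`. -/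
@[ext]
structure Pairing (H : Type*) where
  mate : H → H
  mate_mate : ∀ h, mate (mate h) = h
  mate_ne : ∀ h, mate h ≠ h

/-! ### Counting perfect matchings. -/

namespace Pairing

variable {H V : Type*}

instance [Finite H] : Finite (Pairing H) :=
  Finite.of_injective Pairing.mate fun _ _ h => Pairing.ext h

/-- A pairing that respects a predicate is a pairing of the elements with the predicate together
with a pairing of the elements without it. -/
noncomputable def splitEquiv (p : H → Prop) :
    {f : Pairing H // ∀ h, p (f.mate h) ↔ p h} ≃ Pairing {h // p h} × Pairing {h // ¬ p h} := by
  classical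
  exact
  { toFun := fun f =>
      (⟨fun h => ⟨f.1.mate h, (f.2 h).2 h.2⟩, fun h => Subtype.ext (f.1.mate_mate h),
        fun h e => f.1.mate_ne h (congrArg Subtype.val e)⟩,
       ⟨fun h => ⟨f.1.mate h, fun q => h.2 ((f.2 h).1 q)⟩, fun h => Subtype.ext (f.1.mate_mate h),
        fun h e => f.1.mate_ne h (congrArg Subtype.val e)⟩)
    invFun := fun q =>
      ⟨⟨fun h => if hp : p h then (q.1.mate ⟨h, hp⟩).1 else (q.2.mate ⟨h, hp⟩).1, fun h => by
          by_cases hp : p h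
          · simp [hp, (q.1.mate ⟨h, hp⟩).2, q.1.mate_mate]
          · simp [hp, (q.2.mate ⟨h, hp⟩).2, q.2.mate_mate],
        fun h e => by
          by_cases hp : p h
          · simp only [hp, dite_true] at e
            exact q.1.mate_ne ⟨h, hp⟩ (Subtype.ext e)
          · simp only [hp, dite_false] at e
            exact q.2.mate_ne ⟨h, hp⟩ (Subtype.ext e)⟩,
       fun h => by
          by_cases hp : p h
          · simp [hp, (q.1.mate ⟨h, hp⟩).2]
          · simp [hp, (q.2.mate ⟨h, hp⟩).2]⟩
    left_inv := fun f => by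
      apply Subtype.ext
      ext h
      by_cases hp : p h <;> simp [hp]
    right_inv := fun q => by
      ext h
      · simp [h.2]
      · simp [h.2] }

theorem card_of_card_eq_two [Finite H] (hH : Nat.card H = 2) : Nat.card (Pairing H) = 1 := by
  classical
  obtain ⟨x, y, hxy, hu⟩ := Nat.card_eq_two_iff.1 hH
  have hx : ∀ h, h = x ∨ h = y := fun h => by
    have : h ∈ ({x, y} : Set H) := hu ▸ Set.mem_univ h
    simpa using this
  rw [Nat.card_eq_one_iff_unique]
  refine ⟨⟨fun f g => ?_⟩, ⟨⟨Equiv.swap x y, fun h => Equiv.swap_apply_self .. , fun h => ?_⟩⟩⟩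
  · ext h
    have a := f.mate_ne h
    have b := g.mate_ne h
    rcases hx h with rfl | rfl <;> rcases hx (f.mate h) with e | e <;>
      rcases hx (g.mate h) with e' | e' <;> simp_all
  · rcases hx h with rfl | rfl
    · simpa using hxy.symm
    · simpa using hxy

/-- The number of pairings of a set of `k` elements. -/
def number : ℕ → ℕ
  | 0 => 1
  | 1 => 0
  | k + 2 => (k + 1) * number k

theorem number_odd (k : ℕ) : number (2 * k + 1) = 0 := by
  induction k with
  | zero => rfl
  | succ k ih => rw [show 2 * (k + 1) + 1 = (2 * k + 1) + 2 by ring, number, ih, mul_zero]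

/-- At `k = 0` the truncated subtraction gives `0!! = 1`, in agreement with (-1)!! = 1. -/
theorem number_even (k : ℕ) : number (2 * k) = Nat.doubleFactorial (2 * k - 1) := by
  induction k with
  | zero => rfl
  | succ k ih =>
    rw [show 2 * (k + 1) = 2 * k + 2 by ring, number, ih]
    rcases k with _ | k
    · rfl
    · rw [show 2 * (k + 1) + 2 - 1 = (2 * k + 1) + 2 by omega, Nat.doubleFactorial,
        show 2 * (k + 1) - 1 = 2 * k + 1 by omega]
      ring

/-- Fix an element a: each choice of its mate leaves a pairing of the remaining elements. -/
theorem card_eq_number [Finite H] : Nat.card (Pairing H) = number (Nat.card H) := by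
  classical
  induction hn : Nat.card H using Nat.strong_induction_on generalizing H with
  | _ n ih =>
  have := Fintype.ofFinite H
  rcases n with _ | _ | k
  · have := (Nat.card_eq_zero.1 hn).resolve_right (by simpa using ‹Finite H›)
    rw [number, Nat.card_eq_one_iff_unique]
    exact ⟨⟨fun f g => by ext h; exact isEmptyElim h⟩,
      ⟨⟨id, fun _ => rfl, fun h => isEmptyElim h⟩⟩⟩
  · have := (Nat.card_eq_one_iff_unique.1 hn).1
    obtain ⟨h⟩ := (Nat.card_eq_one_iff_unique.1 hn).2
    rw [number, Nat.card_eq_zero]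
    exact Or.inl ⟨fun f => f.mate_ne h (Subsingleton.elim _ _)⟩
  · have : Nonempty H := by
      by_contra h
      rw [not_nonempty_iff] at h
      simp at hn
    obtain ⟨a⟩ := this
    have key : ∀ b : {b : H // b ≠ a},
        Nat.card {f : Pairing H // f.mate a = b} = number k := fun b => by
      have hc : Nat.card {h // h = a ∨ h = b.1} = 2 := by
        rw [Nat.card_eq_fintype_card, Fintype.card_subtype, ← Finset.card_pair b.2.symm]
        congr 1
        ext h
        simp
      have hd : Nat.card {h // ¬ (h = a ∨ h = b.1)} = k := by
        have := Nat.card_congr (Equiv.sumCompl fun h => h = a ∨ h = b.1)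
        rw [Nat.card_sum, hc] at this
        omega
      -- Having no fixed point, a pairing matches a with b exactly when it preserves {a, b}, so
      -- `splitEquiv` applies.
      have e : {f : Pairing H // f.mate a = b} ≃
          {f : Pairing H // ∀ h, (f.mate h = a ∨ f.mate h = b) ↔ (h = a ∨ h = b)} := by
        refine Equiv.subtypeEquivRight fun f => ⟨fun hf h => ?_, fun hf => ?_⟩
        · have h1 : f.mate b = a := by rw [← hf, f.mate_mate]
          have h2 := f.mate_mate h
          constructor
          · rintro (e | e)
            · right; rw [← h2, e, hf]
            · left; rw [← h2, e, h1]
          · rintro (e | e)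
            · right; rw [e, hf]
            · left; rw [e, h1]
        · exact ((hf a).2 (Or.inl rfl)).resolve_left (f.mate_ne a)
      rw [Nat.card_congr (e.trans (splitEquiv fun h => h = a ∨ h = b.1)), Nat.card_prod, card_of_card_eq_two hc, one_mul]
      exact ih k (by omega) hd
    have e : Pairing H ≃ Σ b : {b : H // b ≠ a}, {f : Pairing H // f.mate a = b} :=
      { toFun := fun f => ⟨⟨f.mate a, f.mate_ne a⟩, ⟨f, rfl⟩⟩
        invFun := fun q => q.2.1
        left_inv := fun f => rfl
        right_inv := fun ⟨⟨b, hb⟩, ⟨f, hf⟩⟩ => by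
          dsimp only at hf
          subst hf
          rfl }
    rw [Nat.card_congr e, Nat.card_sigma, Finset.sum_congr rfl fun b _ => key b, Finset.sum_const,
      Finset.card_univ, smul_eq_mul, number]
    congr 1
    rw [Nat.card_eq_fintype_card] at hn
    rw [Fintype.card_subtype_compl, hn]
    simp

/-! ### The component of a root vertex. -/

/-- The vertices that are reached from `r` along the edges of the pairing `f` of half-edges, where
the half-edge `h` is attached to the vertex `v h`. -/
def reach (v : H → V) (r : V) (f : Pairing H) : Set V :=
  {u | Relation.ReflTransGen (fun a b => ∃ h, v h = a ∧ v (f.mate h) = b) r u}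

theorem mem_reach_mate {v : H → V} {r : V} {f : Pairing H} {h : H} (hh : v h ∈ reach v r f) :
    v (f.mate h) ∈ reach v r f :=
  Relation.ReflTransGen.tail hh ⟨h, rfl, rfl⟩

theorem mem_reach_mate_iff {v : H → V} {r : V} {f : Pairing H} {h : H} :
    v (f.mate h) ∈ reach v r f ↔ v h ∈ reach v r f :=
  ⟨fun hh => by simpa [f.mate_mate] using mem_reach_mate hh, mem_reach_mate⟩

theorem root_mem_reach (v : H → V) (r : V) (f : Pairing H) : r ∈ reach v r f :=
  Relation.ReflTransGen.refl

theorem exists_of_mem_reach {v : H → V} {r u : V} {f : Pairing H} (hu : u ∈ reach v r f)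
    (hr : u ≠ r) : ∃ h, v h = u := by
  rcases Relation.ReflTransGen.cases_tail hu with h | ⟨_, _, h, _, h'⟩
  · exact absurd h hr
  · exact ⟨_, h'⟩

/-- The number of pairings for which the vertices reached from `r` are those in `B`. -/
noncomputable def reachCount (v : H → V) (r : V) (B : Set V) : ℕ :=
  Nat.card {f : Pairing H // reach v r f = B}

/-- No edge leaves B, so a path that starts at r uses only half-edges over B. -/
theorem reach_splitEquiv (v : H → V) (r : V) (B : Set V) (hr : r ∈ B)
    (f : {f : Pairing H // ∀ h, v (f.mate h) ∈ B ↔ v h ∈ B}) :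
    reach (fun h : {h // v h ∈ B} => v h) r (splitEquiv (fun h => v h ∈ B) f).1
      = reach v r f.1 := by
  ext u
  constructor
  · intro hu
    induction hu with
    | refl => exact root_mem_reach ..
    | tail _ hbc ih =>
      obtain ⟨h, h1, h2⟩ := hbc
      exact Relation.ReflTransGen.tail ih ⟨h.1, h1, h2⟩
  · intro hu
    have : u ∈ reach (fun h : {h // v h ∈ B} => v h) r (splitEquiv (fun h => v h ∈ B) f).1 ∧
        u ∈ B := by
      induction hu with
      | refl => exact ⟨root_mem_reach .., hr⟩
      | tail _ hbc ih =>
        obtain ⟨h, rfl, rfl⟩ := hbc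
        exact ⟨Relation.ReflTransGen.tail ih.1 ⟨⟨h, ih.2⟩, rfl, rfl⟩, (f.2 h).2 ih.2⟩
    exact this.1

/-- No edge joins the component of r to its complement, and the half-edges outside may be paired
arbitrarily. -/
theorem reachCount_eq_mul [Finite H] (v : H → V) (r : V) (B : Set V) (hr : r ∈ B) :
    reachCount v r B = reachCount (fun h : {h // v h ∈ B} => v h) r B *
      number (Nat.card {h // v h ∉ B}) := by
  rw [← card_eq_number, reachCount, reachCount, ← Nat.card_prod]
  let e₁ : {f : Pairing H // reach v r f = B} ≃
      {f : {f : Pairing H // ∀ h, v (f.mate h) ∈ B ↔ v h ∈ B} // reach v r f.1 = B} :=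
    { toFun := fun f => ⟨⟨f.1, fun h => by
        have := mem_reach_mate_iff (v := v) (r := r) (f := f.1) (h := h)
        rwa [f.2] at this⟩, f.2⟩
      invFun := fun f => ⟨f.1.1, f.2⟩
      left_inv := fun _ => rfl
      right_inv := fun _ => rfl }
  let e₂ : {f : {f : Pairing H // ∀ h, v (f.mate h) ∈ B ↔ v h ∈ B} // reach v r f.1 = B} ≃
      {q : Pairing {h // v h ∈ B} × Pairing {h // v h ∉ B} //
        reach (fun h : {h // v h ∈ B} => v h) r q.1 = B} :=
    (splitEquiv fun h => v h ∈ B).subtypeEquiv fun f => by rw [reach_splitEquiv v r B hr]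
  let e₃ : {q : Pairing {h // v h ∈ B} × Pairing {h // v h ∉ B} //
        reach (fun h : {h // v h ∈ B} => v h) r q.1 = B} ≃
      {f : Pairing {h // v h ∈ B} // reach (fun h : {h // v h ∈ B} => v h) r f = B} ×
        Pairing {h // v h ∉ B} :=
    { toFun := fun q => (⟨q.1.1, q.2⟩, q.1.2)
      invFun := fun q => ⟨(q.1.1, q.2), q.1.2⟩
      left_inv := fun _ => rfl
      right_inv := fun _ => rfl }
  exact Nat.card_congr ((e₁.trans e₂).trans e₃)

theorem sum_reachCount [Finite H] [DecidableEq V] (v : H → V) (r : V)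
    (s : Finset V) (hr : r ∈ s) (hv : ∀ h, v h ∈ s) :
    ∑ t ∈ s.powerset, reachCount v r (t : Set V) = number (Nat.card H) := by
  classical
  have := Fintype.ofFinite (Pairing H)
  have hsub : ∀ f : Pairing H, reach v r f ⊆ s := fun f u hu => by
    by_cases h : u = r
    · exact h ▸ hr
    · obtain ⟨x, rfl⟩ := exists_of_mem_reach hu h
      exact hv x
  rw [← card_eq_number, Nat.card_eq_fintype_card, ← Finset.card_univ,
    Finset.card_eq_sum_card_fiberwise (f := fun f => s.filter (· ∈ reach v r f))
      (t := s.powerset) (fun f _ => by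
        exact Finset.mem_coe.2 (Finset.mem_powerset.2 (Finset.filter_subset _ s)))]
  refine Finset.sum_congr rfl fun t ht => ?_
  rw [reachCount, Nat.card_eq_fintype_card, Fintype.card_subtype]
  congr 1
  ext f
  simp only [Finset.mem_filter, Finset.mem_univ, true_and]
  rw [← Finset.coe_inj, Finset.coe_filter]
  have : {x | x ∈ s ∧ x ∈ reach v r f} = reach v r f := by
    ext x; exact ⟨fun h => h.2, fun h => ⟨hsub f h, h⟩⟩
  rw [this]

end Pairing

/-! ### Rational functions without integral poles. -/

/-- A function on the integers that is given by a rational function without integral poles. -/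
def RegularRational (f : ℤ → ℚ) : Prop :=
  ∃ p q : Polynomial ℚ, ∀ z : ℤ, q.eval (z : ℚ) ≠ 0 ∧ f z = p.eval (z : ℚ) / q.eval (z : ℚ)

namespace RegularRational

theorem const (c : ℚ) : RegularRational fun _ => c :=
  ⟨Polynomial.C c, 1, fun z => by simp⟩

theorem mul {f g : ℤ → ℚ} (hf : RegularRational f) (hg : RegularRational g) :
    RegularRational fun z => f z * g z := by
  obtain ⟨p, q, h⟩ := hf
  obtain ⟨p', q', h'⟩ := hg
  refine ⟨p * p', q * q', fun z => ⟨?_, ?_⟩⟩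
  · simpa using ⟨(h z).1, (h' z).1⟩
  · simp only [(h z).2, (h' z).2, Polynomial.eval_mul, Polynomial.eval_mul, div_mul_div_comm]

theorem add {f g : ℤ → ℚ} (hf : RegularRational f) (hg : RegularRational g) :
    RegularRational fun z => f z + g z := by
  obtain ⟨p, q, h⟩ := hf
  obtain ⟨p', q', h'⟩ := hg
  refine ⟨p * q' + q * p', q * q', fun z => ⟨?_, ?_⟩⟩
  · simpa using ⟨(h z).1, (h' z).1⟩
  · simp only [(h z).2, (h' z).2, Polynomial.eval_mul, Polynomial.eval_add,
      div_add_div _ _ (h z).1 (h' z).1]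

theorem sub {f g : ℤ → ℚ} (hf : RegularRational f) (hg : RegularRational g) :
    RegularRational fun z => f z - g z := by
  simpa [sub_eq_add_neg] using hf.add ((const (-1)).mul hg)

theorem sum {ι : Type*} (s : Finset ι) {f : ι → ℤ → ℚ} (hf : ∀ k ∈ s, RegularRational (f k)) :
    RegularRational fun z => ∑ k ∈ s, f k z := by
  classical
  induction s using Finset.induction_on with
  | empty => simpa using const 0
  | insert a s ha ih =>
    simp only [Finset.sum_insert ha]
    exact (hf a (by simp)).add (ih fun k hk => hf k (by simp [hk]))

theorem prod {ι : Type*} (s : Finset ι) {f : ι → ℤ → ℚ} (hf : ∀ k ∈ s, RegularRational (f k)) :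
    RegularRational fun z => ∏ k ∈ s, f k z := by
  classical
  induction s using Finset.induction_on with
  | empty => simpa using const 1
  | insert a s ha ih =>
    simp only [Finset.prod_insert ha]
    exact (hf a (by simp)).mul (ih fun k hk => hf k (by simp [hk]))

theorem shift {f : ℤ → ℚ} (hf : RegularRational f) (c : ℤ) :
    RegularRational fun z => f (z + c) := by
  obtain ⟨p, q, h⟩ := hf
  refine ⟨p.comp (Polynomial.X + Polynomial.C (c : ℚ)),
    q.comp (Polynomial.X + Polynomial.C (c : ℚ)), fun z => ?_⟩
  simpa using h (z + c)

/-- This parity is why no poles arise: up to shifts, 2z - 1 is the only denominator that enters. -/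
theorem two_mul_sub_one_ne_zero (z : ℤ) : 2 * (z : ℚ) - 1 ≠ 0 := by
  intro h
  have : 2 * z - 1 = 0 := by exact_mod_cast h
  omega

theorem inv_odd : RegularRational fun z => (2 * (z : ℚ) - 1)⁻¹ :=
  ⟨1, Polynomial.C 2 * Polynomial.X - 1, fun z => by
    simpa using two_mul_sub_one_ne_zero z⟩

theorem exists_ratFunc {f : ℤ → ℚ} (hf : RegularRational f) :
    ∃ R : RatFunc ℚ, ∀ z : ℤ, Polynomial.eval (z : ℚ) R.denom ≠ 0 ∧
      f z = RatFunc.eval (RingHom.id ℚ) (z : ℚ) R := by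
  obtain ⟨p, q, h⟩ := hf
  have hq : q ≠ 0 := by
    rintro rfl
    exact (h 0).1 (by simp)
  refine ⟨algebraMap _ _ p / algebraMap _ _ q, fun z => ?_⟩
  -- The reduced denominator divides `q`, so it has no new zeros.
  have hd : Polynomial.eval (z : ℚ)
      (algebraMap (Polynomial ℚ) (RatFunc ℚ) p / algebraMap _ _ q).denom ≠ 0 := fun h0 =>
    (h z).1 (Polynomial.eval_eq_zero_of_dvd_of_eval_eq_zero (RatFunc.denom_div_dvd p q) h0)
  refine ⟨hd, ?_⟩
  have hm := (RatFunc.num_mul_eq_mul_denom_iff (x := algebraMap (Polynomial ℚ) (RatFunc ℚ) p /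
    algebraMap _ _ q) (p := p) hq).2 rfl
  have hm' := congrArg (Polynomial.eval (z : ℚ)) hm
  rw [Polynomial.eval_mul, Polynomial.eval_mul] at hm'
  rw [(h z).2, RatFunc.eval, ← Polynomial.eval, ← Polynomial.eval,
    div_eq_div_iff (h z).1 hd, hm']

end RegularRational

/-! ### The probability that a random pairing is connected. -/

namespace Pairing

variable {H V : Type*}

theorem number_eq_mul_prod (E k : ℕ) (hk : k ≤ E) :
    (number (2 * E) : ℚ) =
      number (2 * (E - k)) * ∏ j ∈ Finset.range k, (2 * (((E : ℤ) - j : ℤ) : ℚ) - 1) := by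
  induction k with
  | zero => simp
  | succ k ih =>
    rw [ih (by omega), Finset.prod_range_succ, show 2 * (E - k) = 2 * (E - (k + 1)) + 2 by omega,
      number]
    have : ((2 * (E - (k + 1)) + 1 : ℕ) : ℚ) = 2 * (((E : ℤ) - k : ℤ) : ℚ) - 1 := by
      have : ((2 * (E - (k + 1)) + 1 : ℕ) : ℤ) = 2 * ((E : ℤ) - k) - 1 := by omega
      exact_mod_cast this
    rw [Nat.cast_mul, this]
    ring

theorem card_notMem_eq_sum [Finite H] [DecidableEq V] (v : H → V) (s t : Finset V)
    (hv : ∀ h, v h ∈ s) :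
    Nat.card {h // v h ∉ (t : Set V)} = ∑ k ∈ s \ t, Nat.card {h // v h = k} := by
  have := Fintype.ofFinite H
  classical
  simp only [Nat.card_eq_fintype_card, Fintype.card_subtype, Finset.mem_coe]
  rw [Finset.card_eq_sum_card_fiberwise (f := v) (t := s \ t) fun h hh => by
    simpa [hv h] using hh]
  refine Finset.sum_congr rfl fun k hk => ?_
  congr 1
  ext h
  simp only [Finset.mem_filter, Finset.mem_univ, true_and, and_iff_right_iff_imp]
  rintro rfl
  exact (Finset.mem_sdiff.1 hk).2

theorem reachCount_eq_zero (v : H → V) {r : V} {B : Set V} (hr : r ∉ B) :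
    reachCount v r B = 0 := by
  rw [reachCount, Nat.card_eq_zero]
  exact Or.inl ⟨fun f => hr (f.2 ▸ root_mem_reach v r f.1)⟩

/-- If the number of half-edges at every vertex but `r` is prescribed, then the probability that
a random pairing connects all vertices is a regular rational function of the number of edges. -/
theorem exists_regularRational_reachCount [DecidableEq V] (w : V → ℕ) (r : V) (s : Finset V) :
    ∃ f : ℤ → ℚ, RegularRational f ∧ ∀ (H : Type) [Finite H] (v : H → V), (∀ h, v h ∈ s) →
      (∀ k ∈ s, k ≠ r → Nat.card {h // v h = k} = w k) → ∀ E : ℕ, Nat.card H = 2 * E →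
        (reachCount v r (s : Set V) : ℚ) = number (2 * E) * f E := by
  -- The function depends on `w`, `r` and `s` alone; it is chosen before the half-edges and `E`, so
  -- one function serves all valencies of `r`.
  induction s using Finset.strongInductionOn with
  | _ s ih =>
  by_cases hr : r ∈ s
  swap
  · refine ⟨fun _ => 0, .const 0, fun H _ v _ _ E _ => ?_⟩
    simp [reachCount_eq_zero v (r := r) (B := (s : Set V)) (by simpa using hr)]
  choose! F hF using ih
  let W : Finset V → ℕ := fun t => ∑ k ∈ s \ t, w k
  -- The probability that the component of `r` is `t`: `W t / 2` edges lie outside, whence the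
  -- shift, and the product is the ratio of (2(E-k)-1)!! to (2E-1)!! with k = `W t / 2`.
  let term : Finset V → ℤ → ℚ := fun t z =>
    if r ∈ t ∧ Even (W t) then
      (number (W t) : ℚ) * (F t (z + -((W t / 2 : ℕ) : ℤ)) *
        ∏ j ∈ Finset.range (W t / 2), (2 * ((z + -(j : ℤ) : ℤ) : ℚ) - 1)⁻¹)
    else 0
  have hterm : ∀ t ∈ s.powerset.erase s, RegularRational (term t) := fun t ht => by
    have hts : t ⊂ s := by
      rw [Finset.mem_erase, Finset.mem_powerset] at ht
      exact ht.2.ssubset_of_ne ht.1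
    by_cases h : r ∈ t ∧ Even (W t)
    · simp only [term, if_pos h]
      exact (RegularRational.const _).mul (((hF t hts).1.shift _).mul
        (.prod _ fun j _ => RegularRational.inv_odd.shift (-(j : ℤ))))
    · simp only [term, if_neg h]
      exact .const 0
  -- The probabilities of all components add up to 1.
  refine ⟨fun z => 1 - ∑ t ∈ s.powerset.erase s, term t z,
    (RegularRational.const 1).sub (.sum _ hterm), fun H _ v hv hw E hE => ?_⟩
  have key : ∀ t ∈ s.powerset.erase s,
      (reachCount v r (t : Set V) : ℚ) = number (2 * E) * term t E := fun t ht => by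
    have hts : t ⊂ s := by
      rw [Finset.mem_erase, Finset.mem_powerset] at ht
      exact ht.2.ssubset_of_ne ht.1
    by_cases hrt : r ∈ t
    swap
    · simp [term, hrt, reachCount_eq_zero v (r := r) (B := (t : Set V)) (by simpa using hrt)]
    have hc : Nat.card {h // v h ∉ (t : Set V)} = W t := by
      rw [card_notMem_eq_sum v s t hv]
      refine Finset.sum_congr rfl fun k hk => ?_
      rw [Finset.mem_sdiff] at hk
      exact hw k hk.1 fun e => hk.2 (e ▸ hrt)
    rw [reachCount_eq_mul v r (t : Set V) (by simpa using hrt), hc]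
    by_cases hev : Even (W t)
    swap
    · obtain ⟨k, hk⟩ := Nat.not_even_iff_odd.1 hev
      have : term t E = 0 := if_neg fun h => hev h.2
      rw [this, hk, number_odd]
      simp
    obtain ⟨k, hk⟩ := hev.two_dvd
    have hsum : Nat.card {h // v h ∈ (t : Set V)} + W t = 2 * E := by
      classical
      rw [← hc, ← hE, ← Nat.card_sum]
      exact Nat.card_congr (Equiv.sumCompl fun h => v h ∈ (t : Set V))
    have hH := (hF t hts).2 {h // v h ∈ (t : Set V)} (fun h => v h) (fun h => h.2)
      (fun u hu hur => by
        rw [← hw u (hts.1 hu) hur]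
        exact Nat.card_congr (Equiv.subtypeSubtypeEquivSubtype fun {h} (hh : v h = u) =>
          show v h ∈ (t : Set V) by simpa [hh] using hu))
      (E - k) (by omega)
    have hkE : k ≤ E := by omega
    have ht' : term t E = (number (W t) : ℚ) * (F t ((E : ℤ) + -((W t / 2 : ℕ) : ℤ)) *
        ∏ j ∈ Finset.range (W t / 2), (2 * (((E : ℤ) + -(j : ℤ) : ℤ) : ℚ) - 1)⁻¹) :=
      if_pos ⟨hrt, hev⟩
    rw [Nat.cast_mul, hH, ht', number_eq_mul_prod E k hkE, hk, Nat.mul_div_cancel_left k two_pos,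
      Finset.prod_inv_distrib, Nat.cast_sub hkE]
    simp only [← sub_eq_add_neg]
    have hne : ∏ j ∈ Finset.range k, (2 * (((E : ℤ) - j : ℤ) : ℚ) - 1) ≠ 0 :=
      Finset.prod_ne_zero_iff.2 fun j _ => RegularRational.two_mul_sub_one_ne_zero _
    field_simp
  have hs := congrArg (Nat.cast : ℕ → ℚ) (sum_reachCount v r s hr hv)
  rw [← Finset.add_sum_erase _ _ (Finset.mem_powerset_self s), hE, Nat.cast_add, Nat.cast_sum,
    Finset.sum_congr rfl key, ← Finset.mul_sum] at hs
  linear_combination hs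

end Pairing

/-! ### Graphs as pairings of half-edges. -/

namespace OrdinaryGraph

variable {n : ℕ} {i : Fin n → ℕ}

theorem two_mul_card_edges (Γ : OrdinaryGraph i) : 2 * Γ.edges.card = ∑ k, i k := by
  have h := Finset.card_eq_sum_card_image (fun h => s(h, Γ.mate h))
    (Finset.univ : Finset (HalfEdge i))
  have hf : ∀ e ∈ Γ.edges, (Finset.univ.filter fun h => s(h, Γ.mate h) = e).card = 2 := by
    intro e he
    obtain ⟨a, -, rfl⟩ := Finset.mem_image.1 he
    rw [← Finset.card_pair (Γ.mate_ne a).symm]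
    congr 1
    ext h
    simp only [Finset.mem_filter, Finset.mem_univ, true_and, Finset.mem_insert,
      Finset.mem_singleton, Sym2.eq_iff]
    constructor
    · rintro (h | h)
      · exact Or.inl h.1
      · exact Or.inr h.1
    · rintro (rfl | rfl)
      · exact Or.inl ⟨rfl, rfl⟩
      · exact Or.inr ⟨rfl, Γ.mate_mate a⟩
  rw [Finset.card_univ, Fintype.card_sigma] at h
  simp only [Fintype.card_fin] at h
  rw [h, mul_comm, ← smul_eq_mul, ← Finset.sum_const]
  exact (Finset.sum_congr rfl hf).symm

/-- The valencies alone determine the genus, so fixing it imposes no condition on the pairing. -/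
theorem genus_eq_iff (Γ : OrdinaryGraph i) (g : ℕ) :
    Γ.genus = g ↔ ∑ k, i k + 2 = 2 * g + 2 * n := by
  have := Γ.two_mul_card_edges
  rw [genus]
  omega

/-- The graph obtained by renaming the half-edges. -/
def rename (Γ : OrdinaryGraph i) (φ : Equiv.Perm (HalfEdge i)) : OrdinaryGraph i where
  mate h := φ (Γ.mate (φ⁻¹ h))
  mate_mate h := by simp [Γ.mate_mate]
  mate_ne h e := Γ.mate_ne (φ⁻¹ h) (φ.injective (e.trans (by simp)))

theorem isIso_iff (Γ Δ : OrdinaryGraph i) (φ : Equiv.Perm (HalfEdge i)) :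
    IsIso Γ Δ φ ↔ (∀ h, (φ h).1 = h.1) ∧ Γ.rename φ = Δ := by
  refine and_congr_right fun _ => ⟨fun h => ?_, ?_⟩
  · ext1
    funext x
    exact (h (φ⁻¹ x)).trans (by simp)
  · rintro rfl h
    simp [rename]

theorem toSimpleGraph_rename (Γ : OrdinaryGraph i) (φ : Equiv.Perm (HalfEdge i))
    (hφ : ∀ h, (φ h).1 = h.1) : (Γ.rename φ).toSimpleGraph = Γ.toSimpleGraph := by
  unfold toSimpleGraph
  congr 1
  funext u v
  refine propext ⟨fun ⟨h, h1, h2⟩ => ⟨φ⁻¹ h, ?_, ?_⟩, fun ⟨h, h1, h2⟩ => ⟨φ h, ?_, ?_⟩⟩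
  · rw [← h1, ← hφ]; simp
  · rw [← h2, rename, hφ]
  · rw [hφ, h1]
  · rw [← h2, rename, hφ]; simp

theorem card_fiberPerm (i : Fin n → ℕ) :
    Nat.card {φ : Equiv.Perm (HalfEdge i) // ∀ h, (φ h).1 = h.1} = ∏ k, (i k).factorial := by
  classical
  have := DomMulAct.stabilizer_card (α := HalfEdge i) (fun h => h.1)
  rw [← Nat.card_eq_fintype_card] at this
  have e : {φ : Equiv.Perm (HalfEdge i) // ∀ h, (φ h).1 = h.1} ≃
      {φ : Equiv.Perm (HalfEdge i) // (fun h : HalfEdge i => h.1) ∘ φ = fun h => h.1} :=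
    Equiv.subtypeEquivRight fun φ => ⟨fun h => funext h, fun h x => congrFun h x⟩
  rw [Nat.card_congr e, this]
  refine Finset.prod_congr rfl fun k _ => ?_
  rw [Fintype.card_congr (Equiv.sigmaSubtype (β := fun k => Fin (i k)) k), Fintype.card_fin]

theorem autCard_ne_zero (Γ : OrdinaryGraph i) : Γ.autCard ≠ 0 := by
  have : Nonempty {φ : Equiv.Perm (HalfEdge i) // IsIso Γ Γ φ} := ⟨⟨1, IsIso.refl Γ⟩⟩
  exact Nat.card_pos.ne'

theorem card_isIso {Γ Δ : OrdinaryGraph i} {φ : Equiv.Perm (HalfEdge i)} (h : IsIso Γ Δ φ) :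
    Nat.card {ψ : Equiv.Perm (HalfEdge i) // IsIso Γ Δ ψ} = Γ.autCard :=
  Nat.card_congr
    { toFun := fun ψ => ⟨φ⁻¹ * ψ.1, ψ.2.trans h.symm⟩
      invFun := fun α => ⟨φ * α.1, α.2.trans h⟩
      left_inv := fun ψ => Subtype.ext (by simp)
      right_inv := fun α => Subtype.ext (by simp) }

/-- A graph is the same as a pairing of its half-edges. -/
def equivPairing (i : Fin n → ℕ) : OrdinaryGraph i ≃ Pairing (HalfEdge i) where
  toFun Γ := ⟨Γ.mate, Γ.mate_mate, Γ.mate_ne⟩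
  invFun f := ⟨f.mate, f.mate_mate, f.mate_ne⟩
  left_inv _ := rfl
  right_inv _ := rfl

theorem connected_iff_reach (Γ : OrdinaryGraph i) (r : Fin n) :
    Γ.toSimpleGraph.Connected ↔
      Pairing.reach (fun h : HalfEdge i => h.1) r (equivPairing i Γ) = Set.univ := by
  have key : ∀ u, Γ.toSimpleGraph.Reachable r u ↔
      u ∈ Pairing.reach (fun h : HalfEdge i => h.1) r (equivPairing i Γ) := fun u => by
    rw [SimpleGraph.reachable_iff_reflTransGen]
    constructor
    · intro hu
      induction hu with
      | refl => exact Pairing.root_mem_reach ..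
      | tail _ hab ih =>
        rw [toSimpleGraph, SimpleGraph.fromRel_adj] at hab
        refine Relation.ReflTransGen.tail ih ?_
        rcases hab.2 with h | ⟨h, h1, h2⟩
        · exact h
        · exact ⟨Γ.mate h, h2, by simpa [equivPairing, Γ.mate_mate] using h1⟩
    · intro hu
      induction hu with
      | refl => exact .refl
      | @tail b c _ hbc ih =>
        by_cases e : b = c
        · exact e ▸ ih
        · refine ih.tail ?_
          rw [toSimpleGraph, SimpleGraph.fromRel_adj]
          exact ⟨e, Or.inl hbc⟩
  rw [Set.eq_univ_iff_forall, SimpleGraph.connected_iff_exists_forall_reachable]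
  simp only [← key]
  exact ⟨fun ⟨a, ha⟩ u => (ha r).symm.trans (ha u), fun h => ⟨r, h⟩⟩

end OrdinaryGraph

/-! ### From weighted isomorphism classes to connected pairings. -/

namespace ConnectedGraph

open OrdinaryGraph

variable {n g : ℕ} {i : Fin n → ℕ}

/-- Orbit-stabilizer: the permutations that fix every vertex act by renaming, the orbit of Γ is its
class, and the permutations taking Γ to a given Δ are a coset of Aut Γ. -/
theorem card_class_mul_autCard (Γ : ConnectedGraph g i) :
    Nat.card {Δ : ConnectedGraph g i // (⟦Δ⟧ : Quotient (isoSetoid g i)) = ⟦Γ⟧} * Γ.1.autCard =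
      ∏ k, (i k).factorial := by
  classical
  let C := {Δ : ConnectedGraph g i // (⟦Δ⟧ : Quotient (isoSetoid g i)) = ⟦Γ⟧}
  have hC : ∀ Δ : C, ∃ φ, IsIso Γ.1 Δ.1.1 φ := fun Δ => Quotient.exact Δ.2.symm
  let e : {φ : Equiv.Perm (HalfEdge i) // ∀ h, (φ h).1 = h.1} ≃
      Σ Δ : C, {φ : Equiv.Perm (HalfEdge i) // IsIso Γ.1 Δ.1.1 φ} :=
    { toFun := fun φ =>
        ⟨⟨⟨Γ.1.rename φ.1, by rw [toSimpleGraph_rename _ _ φ.2]; exact Γ.2.1,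
            (genus_eq_iff _ _).2 ((genus_eq_iff _ _).1 Γ.2.2)⟩,
          (Quotient.sound (s := isoSetoid g i)
            ⟨φ.1, (isIso_iff _ _ _).2 ⟨φ.2, rfl⟩⟩ : _ = _).symm⟩,
          ⟨φ.1, (isIso_iff _ _ _).2 ⟨φ.2, rfl⟩⟩⟩
      invFun := fun q => ⟨q.2.1, q.2.2.1⟩
      left_inv := fun _ => rfl
      right_inv := fun ⟨⟨⟨Δ, hΔ⟩, h⟩, ⟨φ, hφ⟩⟩ => by
        obtain ⟨h1, h2⟩ := (isIso_iff _ _ _).1 hφ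
        dsimp only at h2
        subst h2
        rfl }
  have := Fintype.ofFinite C
  rw [← card_fiberPerm, Nat.card_congr e, Nat.card_sigma,
    Finset.sum_congr rfl fun Δ _ => card_isIso (hC Δ).choose_spec, Finset.sum_const,
    Finset.card_univ, smul_eq_mul, Nat.card_eq_fintype_card]

theorem finsum_classWeight :
    ∑ᶠ c : Quotient (isoSetoid g i), classWeight c =
      Nat.card (ConnectedGraph g i) / ∏ k, ((i k).factorial : ℚ) := by
  classical
  have := Fintype.ofFinite (Quotient (isoSetoid g i))
  have hp : ∏ k, ((i k).factorial : ℚ) ≠ 0 :=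
    Finset.prod_ne_zero_iff.2 fun k _ => by exact_mod_cast (i k).factorial_ne_zero
  have key : ∀ c : Quotient (isoSetoid g i), classWeight c =
      (Nat.card {Δ : ConnectedGraph g i // (⟦Δ⟧ : Quotient (isoSetoid g i)) = c} : ℚ) /
        ∏ k, ((i k).factorial : ℚ) := fun c => by
    induction c using Quotient.inductionOn with
    | _ Γ =>
    change (1 : ℚ) / (Γ.1.autCard : ℚ) = _
    have h0 : (Γ.1.autCard : ℚ) ≠ 0 := by exact_mod_cast Γ.1.autCard_ne_zero
    rw [div_eq_div_iff h0 hp, one_mul]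
    exact_mod_cast (card_class_mul_autCard Γ).symm
  rw [finsum_eq_sum_of_fintype, Finset.sum_congr rfl fun c _ => key c, ← Finset.sum_div,
    ← Nat.cast_sum, ← Nat.card_sigma]
  congr 2
  exact Nat.card_congr
    (Equiv.sigmaFiberEquiv fun Δ : ConnectedGraph g i => (⟦Δ⟧ : Quotient (isoSetoid g i)))

theorem card_eq_reachCount (hi : ∑ k, i k + 2 = 2 * g + 2 * n) (r : Fin n) :
    Nat.card (ConnectedGraph g i) =
      Pairing.reachCount (fun h : HalfEdge i => h.1) r Set.univ :=
  Nat.card_congr ((equivPairing i).subtypeEquiv fun Γ => by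
    rw [← connected_iff_reach, genus_eq_iff, and_iff_left hi])

end ConnectedGraph

/-! ### Conclusion. -/

theorem normalizedOg_eq_card_div {n : ℕ} (g : ℕ) (i : Fin n → ℕ) :
    normalizedOg g i =
      Nat.card (ConnectedGraph g i) / (Nat.doubleFactorial (2 * g + 2 * n - 3) : ℚ) := by
  have hp : ∏ k, ((i k).factorial : ℚ) ≠ 0 :=
    Finset.prod_ne_zero_iff.2 fun k _ => by exact_mod_cast (i k).factorial_ne_zero
  have hn : (n.factorial : ℚ) ≠ 0 := by exact_mod_cast n.factorial_ne_zero
  rw [normalizedOg, ogCount, ConnectedGraph.finsum_classWeight]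
  field_simp

/-- Here `n = m + 1`, and `i` lists the first `n - 1` valencies; the last valency is
`2g + 2n - 2 - |i|`, and the genera `g` considered are those for which it is not negative. -/
theorem mainTheorem2 (m : ℕ) (i : Fin m → ℕ) (hi : ∀ k, 1 ≤ i k) :
    ∃ R : RatFunc ℚ, ∀ g : ℕ, ∑ k, i k ≤ 2 * g + 2 * (m + 1) - 2 →
      Polynomial.eval (g : ℚ) R.denom ≠ 0 ∧
      normalizedOg g (Fin.snoc (α := fun _ : Fin (m + 1) => ℕ) i
          (2 * g + 2 * (m + 1) - 2 - ∑ k, i k)) =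
        RatFunc.eval (RingHom.id ℚ) (g : ℚ) R := by
  -- The last entry 0 is a filler: the weight at the root is never used.
  obtain ⟨f, hf, hfr⟩ := Pairing.exists_regularRational_reachCount
    (Fin.snoc (α := fun _ : Fin (m + 1) => ℕ) i 0) (Fin.last m) Finset.univ
  -- `f` takes the number of edges, which is g + m.
  obtain ⟨R, hR⟩ := (hf.shift (m : ℤ)).exists_ratFunc
  refine ⟨R, fun g hg => ⟨by exact_mod_cast (hR g).1, ?_⟩⟩
  have hgR : f ((g : ℤ) + m) = RatFunc.eval (RingHom.id ℚ) (g : ℚ) R := by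
    exact_mod_cast (hR g).2
  set j := Fin.snoc (α := fun _ : Fin (m + 1) => ℕ) i
    (2 * g + 2 * (m + 1) - 2 - ∑ k, i k) with hj
  have hsum : ∑ k, j k = 2 * (g + m) := by
    rw [Fin.sum_univ_castSucc]
    simp only [hj, Fin.snoc_castSucc, Fin.snoc_last]
    omega
  have hcard := hfr (HalfEdge j) (fun h => h.1) (fun h => Finset.mem_univ _)
    (fun k _ hk => by
      rw [Nat.card_congr (Equiv.sigmaSubtype (β := fun k => Fin (j k)) k), Nat.card_fin]
      obtain ⟨k, rfl⟩ := Fin.exists_castSucc_eq.2 hk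
      simp [hj])
    (g + m) (by rw [Nat.card_eq_fintype_card, Fintype.card_sigma, ← hsum]; simp)
  rw [Finset.coe_univ] at hcard
  -- For g = m = 0 both truncated differences are 0, so the double factorials still agree.
  rw [normalizedOg_eq_card_div, ConnectedGraph.card_eq_reachCount (by omega) (Fin.last m), hcard,
    ← hgR, Pairing.number_even, show 2 * g + 2 * (m + 1) - 3 = 2 * (g + m) - 1 by omega,
    Nat.cast_add]
  exact mul_div_cancel_left₀ _ (by exact_mod_cast (Nat.doubleFactorial_pos _).ne')
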